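/- Let $\mathbb K$ be $\mathbb R$ or $\mathbb C$; all spaces are Banach spaces over $\mathbb K$, and operators are bounded and linear. Definitions. Let $X$ be a Banach space and $K\subset X^*$ weak$^*$-compact. For $\varepsilon>0$ let $s_\varepsilon(K)$ be the set of those $x^*\in K$ such that $\operatorname{diam}(V\cap K)>\varepsilon$ for every weak$^*$-neighborhood $V$ of $x^*$, and let $s_\varepsilon(K)=K$ for $\varepsilon\leqslant 0$. The set $K$ has summable Szlenk index if there is $M\geqslant 0$ such that $\sum_{i=1}^n\varepsilon_i\leqslant M$ whenever $\varepsilon_1,\dots,\varepsilon_n\in\mathbb R$ and $s_{\varepsilon_1}\cdots s_{\varepsilon_n}(K)\neq\varnothing$. Let $r_K(x)=\max_{x^*\in K}\operatorname{Re}x^*(x)$ (and $r_\varnothing=0$). For a (non-empty) directed set $D$ and $n\geqslant 1$, let $D^{\leqslant n}=\bigcup_{i=1}^nD^i$; a collection $(x_t)_{t\in D^{\leqslant n}}\subset X$ is weakly null if for each $t\in\{\varnothing\}\cup D^{\leqslant n-1}$ the net $(x_{t\smallfrown u})_{u\in D}$ is weakly null, where $t\smallfrown u$ is $t$ followed by $u$.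 Let $t|_i$ be the initial segment of $t$ of length $i$. Let $\Sigma_n(K)$ be the infimum of those $s>0$ such that for every directed set $D$ and every weakly null $(x_t)_{t\in D^{\leqslant n}}$ in the closed unit ball $B_X$, $$\inf_{t\in D^n}r_K\Bigl(\sum_{i=1}^nx_{t|_i}\Bigr)\leqslant s,$$ and let $\Sigma(K)=\sup_{n\geqslant 1}\Sigma_n(K)\in[0,\infty]$. For an operator $A:X\to Y$, put $\Sigma_n(A)=\Sigma_n(A^*B_{Y^*})$ and $\Sigma(A)=\Sigma(A^*B_{Y^*})$, and say that $A$ has summable Szlenk index if $A^*B_{Y^*}$ has. For a family $a=(a_\lambda)_{\lambda\in\Lambda}$ in $[0,\infty]$, $\|a\|_{\ell_p(\Lambda)}\in[0,\infty]$ is $(\sum_\lambda a_\lambda^p)^{1/p}$ if $p<\infty$ and $\sup_\lambda a_\lambda$ if $p=\infty$, and $a\in\ell_p(\Lambda)$ means that all $a_\lambda$ and $\|a\|_{\ell_p(\Lambda)}$ are finite. Theorem. Let $1\leqslant p\leqslant\infty$, let $\Lambda$ be a non-empty set, and for each $\lambda\in\Lambda$ let $A_\lambda:X_\lambda\to Y_\lambda$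 be an operator, with $\sup_\lambda\|A_\lambda\|<\infty$. Let $$A:\Bigl(\bigoplus_{\lambda\in\Lambda}X_\lambda\Bigr)_{\ell_p(\Lambda)}\to\Bigl(\bigoplus_{\lambda\in\Lambda}Y_\lambda\Bigr)_{\ell_p(\Lambda)},\qquad A\bigl((x_\lambda)_\lambda\bigr)=(A_\lambda x_\lambda)_\lambda .$$ 1. $A$ has summable Szlenk index if and only if $(\|A_\lambda\|)_{\lambda\in\Lambda}\in c_0(\Lambda)$ and $(\Sigma(A_\lambda))_{\lambda\in\Lambda}\in\ell_p(\Lambda)$. 2. In this case, $\Sigma(A)=\|(\Sigma(A_\lambda))_{\lambda\in\Lambda}\|_{\ell_p(\Lambda)}$. 3. If $\Lambda$ is finite, then (with no further assumption, and with values in $[0,\infty]$) $\Sigma_n(A)\leqslant\|(\Sigma_n(A_\lambda))_{\lambda\in\Lambda}\|_{\ell_p(\Lambda)}$ for every $n\geqslant 1$, and $\Sigma(A)=\|(\Sigma(A_\lambda))_{\lambda\in\Lambda}\|_{\ell_p(\Lambda)}$. -/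

import Mathlib

open Filter Topology
open scoped ENNReal

universe u v w

namespace Szlenk

noncomputable section

section Sets

variable {𝕜 : Type w} [RCLike 𝕜] {X : Type u} [NormedAddCommGroup X] [NormedSpace 𝕜 X]

/-- The derivation `s_ε` on subsets `K` of the dual `X*`: for `ε > 0`, the set of all `f ∈ K` such
that `diam (V ∩ K) > ε` for every weak* neighbourhood `V` of `f` (the diameter is taken for the
dual norm); for `ε ≤ 0`, `s_ε(K) = K`. -/
def szlenkDeriv (ε : ℝ) (K : Set (StrongDual 𝕜 X)) : Set (StrongDual 𝕜 X) :=
  if ε ≤ 0 then K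
  else {f ∈ K | ∀ V : Set (WeakDual 𝕜 X), V ∈ 𝓝 (StrongDual.toWeakDual f) →
    ENNReal.ofReal ε < Metric.ediam ((StrongDual.toWeakDual ⁻¹' V) ∩ K)}

/-- `K` has `M`-summable Szlenk index: `ε₁ + ⋯ + εₙ ≤ M` whenever `s_{ε₁} ⋯ s_{εₙ}(K) ≠ ∅`. -/
def IsSummableWith (M : ℝ) (K : Set (StrongDual 𝕜 X)) : Prop :=
  ∀ l : List ℝ, (l.foldr szlenkDeriv K).Nonempty → l.sum ≤ M

/-- `K` has summable Szlenk index. -/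
def IsSummable (K : Set (StrongDual 𝕜 X)) : Prop :=
  ∃ M : ℝ, 0 ≤ M ∧ IsSummableWith M K

/-- `r_K(x) = max {Re f(x) : f ∈ K}`, and `0` if `K` is empty. -/
def supportFn (K : Set (StrongDual 𝕜 X)) (x : X) : ℝ :=
  sSup ((fun f : StrongDual 𝕜 X => RCLike.re (f x)) '' K)

variable (𝕜) in
/-- A weakly null collection `(x_t)`, `t ∈ D ∪ D² ∪ ⋯ ∪ Dⁿ`, in the unit ball of `X`: for each
`t` of length `< n` (the empty one included), the net `(x_{t ⌢ d})_{d ∈ D}` is weakly null.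
Elements of `Dᵏ` are lists of length `k`; the values of `x` at lists whose length is not in
`{1, …, n}` play no role. -/
def IsWeaklyNullTree {D : Type v} [Preorder D] (n : ℕ) (x : List D → X) : Prop :=
  (∀ t : List D, 1 ≤ t.length → t.length ≤ n → ‖x t‖ ≤ 1) ∧
  ∀ t : List D, t.length < n →
    Tendsto (fun d : D => toWeakSpace 𝕜 X (x (t ++ [d]))) atTop (𝓝 0)

/-- `x_{t|1} + ⋯ + x_{t|n}` for `t ∈ Dⁿ`. -/
def branchSum {D : Type v} {n : ℕ} (x : List D → X) (t : List.Vector D n) : X :=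
  ∑ i ∈ Finset.range n, x (t.toList.take (i + 1))

/-- `Σₙ(K) ∈ [0, ∞]`: the infimum of those `s > 0` such that for every directed set `D` and every
weakly null collection `(x_t)`, `t ∈ D ∪ ⋯ ∪ Dⁿ`, in the unit ball of `X`,
`inf {r_K(x_{t|1} + ⋯ + x_{t|n}) : t ∈ Dⁿ} ≤ s`. -/
def sigmaN (n : ℕ) (K : Set (StrongDual 𝕜 X)) : ℝ≥0∞ :=
  sInf {a : ℝ≥0∞ | ∃ s : ℝ, 0 < s ∧ a = ENNReal.ofReal s ∧
    ∀ (D : Type u) [Preorder D] [IsDirectedOrder D] [Nonempty D] (x : List D → X),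
      IsWeaklyNullTree 𝕜 n x → ⨅ t : List.Vector D n, supportFn K (branchSum x t) ≤ s}

/-- `Σ(K) = sup {Σₙ(K) : n ≥ 1}`. -/
def sigma (K : Set (StrongDual 𝕜 X)) : ℝ≥0∞ :=
  ⨆ (n : ℕ) (_ : 1 ≤ n), sigmaN n K

end Sets

section Operators

variable {𝕜 : Type w} [RCLike 𝕜] {X : Type u} [NormedAddCommGroup X] [NormedSpace 𝕜 X]
  {Y : Type v} [NormedAddCommGroup Y] [NormedSpace 𝕜 Y]

/-- `A* B_{Y*}`, the image of the closed unit ball of `Y*` under the adjoint `A* g = g ∘ A`. -/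
def adjointBall (A : X →L[𝕜] Y) : Set (StrongDual 𝕜 X) :=
  (fun g : StrongDual 𝕜 Y => g.comp A) '' Metric.closedBall 0 1

/-- The operator `A` has summable Szlenk index. -/
def HasSummableIndex (A : X →L[𝕜] Y) : Prop := IsSummable (adjointBall A)

/-- `Σₙ(A) = Σₙ(A* B_{Y*})`. -/
def opSigmaN (n : ℕ) (A : X →L[𝕜] Y) : ℝ≥0∞ := sigmaN n (adjointBall A)

/-- `Σ(A) = Σ(A* B_{Y*})`. -/
def opSigma (A : X →L[𝕜] Y) : ℝ≥0∞ := sigma (adjointBall A)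

end Operators

section DirectSums

/-- The `ℓ_p` norm, in `[0, ∞]`, of a family of elements of `[0, ∞]` (for `1 ≤ p ≤ ∞`). -/
def ellNorm {ι : Type u} (p : ℝ≥0∞) (a : ι → ℝ≥0∞) : ℝ≥0∞ :=
  if p = ∞ then ⨆ i, a i else (∑' i, a i ^ p.toReal) ^ (1 / p.toReal)

variable {𝕜 : Type w} [RCLike 𝕜] {ι : Type*} {X : ι → Type u} {Y : ι → Type v}
  [∀ i, NormedAddCommGroup (X i)] [∀ i, NormedSpace 𝕜 (X i)]
  [∀ i, NormedAddCommGroup (Y i)] [∀ i, NormedSpace 𝕜 (Y i)]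

theorem norm_apply_le_norm_smul (A : ∀ i, X i →L[𝕜] Y i) {C : ℝ} (hC : ∀ i, ‖A i‖ ≤ C)
    (x : ∀ i, X i) (i : ι) : ‖A i (x i)‖ ≤ ‖((C : 𝕜) • x) i‖ := by
  have h0 : 0 ≤ C := (norm_nonneg _).trans (hC i)
  rw [Pi.smul_apply, norm_smul, RCLike.norm_ofReal, abs_of_nonneg h0]
  exact (A i).le_of_opNorm_le (hC i) _

/-- The operator `(x_i) ↦ (A_i x_i)` between the `ℓ_p` direct sums, induced by a uniformly bounded
family of operators `A_i : X_i → Y_i`. -/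
def lpMap (p : ℝ≥0∞) [Fact (1 ≤ p)] (A : ∀ i, X i →L[𝕜] Y i)
    (hA : BddAbove (Set.range fun i => ‖A i‖)) : lp X p →L[𝕜] lp Y p :=
  LinearMap.mkContinuousOfExistsBound
    { toFun := fun x => ⟨fun i => A i (x i), by
        obtain ⟨C, hC⟩ := hA
        exact ((lp.memℓp x).const_smul (C : 𝕜)).mono'
          (norm_apply_le_norm_smul A (fun i => hC ⟨i, rfl⟩) x)⟩
      map_add' := fun x y => by ext i; exact map_add (A i) _ _
      map_smul' := fun c x => by ext i; exact map_smul (A i) _ _ }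
    (by
      obtain ⟨C, hC⟩ := hA
      have hp : p ≠ 0 := (zero_lt_one.trans_le (Fact.out : 1 ≤ p)).ne'
      refine ⟨‖(C : 𝕜)‖, fun x => ?_⟩
      rw [← lp.norm_const_smul hp]
      exact lp.norm_mono hp (norm_apply_le_norm_smul A (fun i => hC ⟨i, rfl⟩) x))

@[simp]
theorem lpMap_apply (p : ℝ≥0∞) [Fact (1 ≤ p)] (A : ∀ i, X i →L[𝕜] Y i)
    (hA : BddAbove (Set.range fun i => ‖A i‖)) (x : lp X p) (i : ι) :
    lpMap p A hA x i = A i (x i) := rfl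

end DirectSums

end

end Szlenk

/-!
For an operator `A : X → Y` let `ρ₀(z) = ‖A z‖` and `ρₙ₊₁(z) = limsup ρₙ(z + x)`, where `x` tends
weakly to `0` in the closed unit ball (`iterLimsup`). Since the support function of `A* B_{Y*}` is
`x ↦ ‖A x‖`, a game argument on trees gives `Σₙ(A) = ρₙ(0)` (`opSigmaN_eq_iterLimsup`), and everything
is proved for `ρₙ` by induction on `n`.

*Summability.* `A` has summable Szlenk index if and only if `Σ(A) < ∞` (`hasSummableIndex_iff`). If
`ρₙ(z) > a`, then norming functionals of `A* B_{Y*}`, followed through weak* limits along the `n`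
upper limits, end in some `f ∈ s_{ε₁} ⋯ s_{εₙ}(A* B_{Y*})` with `Re f(z) + ∑ εᵢ` almost `a`: whatever
the functionals take on a weakly null net is lost in the weak* limit, hence is a lower bound for the
diameters. Conversely a point `f` of `s_{ε₁} ⋯ s_{εₙ}(A* B_{Y*})` forces
`ρₙ(z) ≥ Re f(z) + ∑ εᵢ / 4`. Here weakly null points are obtained without any assumption on `X`, as
halved differences of two points of the unit ball chosen along an ultrafilter
(`tendsto_half_sub_weakNull`).

*Direct sums.* Putting weakly null trees of the summands one after the other gives
`‖(Σ(A_λ))‖_p ≤ Σ(A)` with no assumption (`ellNorm_opSigma_le`). The opposite inequality holds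
level by level, with `Σₙ`, when `‖A_λ‖ → 0` (`opSigmaN_lpMap_le`): finitely many coordinates of a
weakly null net are controlled simultaneously, and the others contribute at most `n τ`, where `τ`
bounds their norms.

*Necessity of `‖A_λ‖ → 0`.* If infinitely many of the norms exceed some `δ > 0`, then `A` is bounded
below on a copy of `ℓ_p` if `p < ∞`, and on a copy of `ℓ₁` if `p = ∞`. Halved differences of the basis
vectors then give weakly null trees with unbounded branch sums, so that `Σ(A) = ∞`
(`tendsto_norm_of_opSigma_ne_top`).
-/

namespace Szlenk

/-! ### The filter of weakly null points of the unit ball -/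

section WeaklyNull

variable (𝕜 : Type w) [RCLike 𝕜] (X : Type u) [NormedAddCommGroup X] [NormedSpace 𝕜 X]

/-- The trace on the closed unit ball of the filter of weak neighbourhoods of `0`. -/
noncomputable def weakNull : Filter X :=
  comap (toWeakSpace 𝕜 X) (𝓝 0) ⊓ 𝓟 (Metric.closedBall 0 1)

variable {X}

theorem zero_mem_of_mem_weakNull {s : Set X} (hs : s ∈ weakNull 𝕜 X) : (0 : X) ∈ s := by
  obtain ⟨U, ⟨V, hV, hVU⟩, W, hW, rfl⟩ := hs
  exact ⟨hVU (by simpa using mem_of_mem_nhds hV), hW (by simp)⟩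

instance weakNull_neBot : (weakNull 𝕜 X).NeBot :=
  ⟨fun h => by
    have : (∅ : Set X) ∈ weakNull 𝕜 X := by rw [h]; exact mem_bot
    exact (zero_mem_of_mem_weakNull 𝕜 this).elim⟩

theorem eventually_weakNull_norm_le : ∀ᶠ x in weakNull 𝕜 X, ‖x‖ ≤ 1 := by
  filter_upwards [mem_inf_of_right (mem_principal_self _)] with x hx
  simpa using hx

variable {𝕜}

theorem tendsto_toWeakSpace_zero_iff {α : Type*} {l : Filter α} {x : α → X} :
    Tendsto (fun a => toWeakSpace 𝕜 X (x a)) l (𝓝 0) ↔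
      ∀ f : StrongDual 𝕜 X, Tendsto (fun a => f (x a)) l (𝓝 0) := by
  have hinj : Function.Injective (topDualPairing 𝕜 X).flip := by
    intro a b hab
    refine (SeparatingDual.eq_iff_forall_dual_eq (R := 𝕜)).2 fun f => ?_
    exact DFunLike.congr_fun hab f
  have := WeakBilin.tendsto_iff_forall_eval_tendsto (l := l)
    (f := fun a => toWeakSpace 𝕜 X (x a)) (x := 0) (topDualPairing 𝕜 X).flip hinj
  refine this.trans (forall_congr' fun f => ?_)
  exact iff_of_eq (congrArg (Tendsto _ l) (congrArg 𝓝 (map_zero f)))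

/-- A family in the unit ball converges along `weakNull` as soon as every functional tends to
`0` on it. -/
theorem tendsto_weakNull_iff {α : Type*} {l : Filter α} {x : α → X} :
    Tendsto x l (weakNull 𝕜 X) ↔
      (∀ f : StrongDual 𝕜 X, Tendsto (fun a => f (x a)) l (𝓝 0)) ∧ ∀ᶠ a in l, ‖x a‖ ≤ 1 := by
  rw [weakNull, tendsto_inf, tendsto_comap_iff, tendsto_principal]
  simp only [Metric.mem_closedBall, dist_zero_right]
  exact and_congr_left' tendsto_toWeakSpace_zero_iff

theorem tendsto_eval_weakNull (f : StrongDual 𝕜 X) : Tendsto f (weakNull 𝕜 X) (𝓝 0) :=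
  (tendsto_weakNull_iff.1 (tendsto_id (α := X))).1 f

theorem tendsto_re_eval_weakNull (f : StrongDual 𝕜 X) :
    Tendsto (fun x => RCLike.re (f x)) (weakNull 𝕜 X) (𝓝 0) := by
  have := (RCLike.continuous_re.tendsto (0 : 𝕜)).comp (tendsto_eval_weakNull f)
  rwa [map_zero] at this

theorem tendsto_weakNull_of_norm_le {Z : Type*} [NormedAddCommGroup Z] [NormedSpace 𝕜 Z]
    (T : X →L[𝕜] Z) (hT : ∀ x, ‖T x‖ ≤ ‖x‖) : Tendsto T (weakNull 𝕜 X) (weakNull 𝕜 Z) :=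
  tendsto_weakNull_iff.2 ⟨fun f => tendsto_eval_weakNull (f.comp T),
    (eventually_weakNull_norm_le 𝕜).mono fun x hx => (hT x).trans hx⟩

/-- Every functional converges along an ultrafilter on a bounded family, so that halved differences
of two members of the family, both chosen along the ultrafilter, are weakly null. -/
theorem tendsto_half_sub_weakNull {ι : Type*} (l : Ultrafilter ι) (x : ι → X)
    (hx : ∀ i, ‖x i‖ ≤ 1) :
    Tendsto (fun q : ι × ι => (2⁻¹ : 𝕜) • (x q.2 - x q.1)) (l ×ˢ l : Filter (ι × ι))
      (weakNull 𝕜 X) := by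
  refine tendsto_weakNull_iff.2 ⟨fun f => ?_, Eventually.of_forall fun q => ?_⟩
  · obtain ⟨c, -, hc⟩ : ∃ c ∈ Metric.closedBall (0 : 𝕜) ‖f‖, Tendsto (fun i => f (x i)) l (𝓝 c) := by
      refine (isCompact_closedBall (0 : 𝕜) ‖f‖).ultrafilter_le_nhds
        (l.map fun i => f (x i)) ?_
      rw [le_principal_iff]
      refine mem_map.2 (Eventually.of_forall fun i => ?_)
      simpa using f.le_of_opNorm_le_of_le le_rfl (hx i)
    have := ((hc.comp (tendsto_snd (f := (l : Filter ι)))).sub (hc.comp tendsto_fst)).const_mul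
      (2⁻¹ : 𝕜)
    simpa using this
  · rw [norm_smul, norm_inv, RCLike.norm_ofNat]
    have := (norm_sub_le (x q.2) (x q.1)).trans (add_le_add (hx q.2) (hx q.1))
    linarith

end WeaklyNull

/-! ### Iterated upper limits along weakly null nets -/

section IterLimsup

variable {𝕜 : Type w} [RCLike 𝕜] {X : Type u} [NormedAddCommGroup X] [NormedSpace 𝕜 X]
  {Y : Type v} [NormedAddCommGroup Y] [NormedSpace 𝕜 Y]

/-- The `n`-fold iterated upper limit of `‖A (z + x₁ + ⋯ + xₙ)‖` as `xₙ`, then `xₙ₋₁`, …, then `x₁`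
tend weakly to `0` in the closed unit ball. -/
noncomputable def iterLimsup (A : X →L[𝕜] Y) : ℕ → X → ℝ≥0∞
  | 0, z => ‖A z‖ₑ
  | n + 1, z => limsup (fun x => iterLimsup A n (z + x)) (weakNull 𝕜 X)

theorem iterLimsup_zero (A : X →L[𝕜] Y) (z : X) : iterLimsup A 0 z = ‖A z‖ₑ := rfl

theorem iterLimsup_succ (A : X →L[𝕜] Y) (n : ℕ) (z : X) :
    iterLimsup A (n + 1) z = limsup (fun x => iterLimsup A n (z + x)) (weakNull 𝕜 X) := rfl

theorem le_iterLimsup_succ (A : X →L[𝕜] Y) (n : ℕ) (z : X) :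
    iterLimsup A n z ≤ iterLimsup A (n + 1) z := by
  refine le_limsup_of_frequently_le' fun h => zero_mem_of_mem_weakNull 𝕜 h ?_
  simp

theorem monotone_iterLimsup (A : X →L[𝕜] Y) (z : X) : Monotone fun n => iterLimsup A n z :=
  monotone_nat_of_le_succ fun n => le_iterLimsup_succ A n z

/-- The support function of `A* B_{Y*}` is `x ↦ ‖A x‖`. -/
theorem supportFn_adjointBall (A : X →L[𝕜] Y) (x : X) : supportFn (adjointBall A) x = ‖A x‖ := by
  refine IsGreatest.csSup_eq ⟨?_, ?_⟩
  · obtain ⟨g, hg, hgx⟩ := exists_dual_vector'' 𝕜 (A x)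
    exact ⟨g.comp A, ⟨g, by simpa using hg, rfl⟩, by simp [hgx]⟩
  · rintro _ ⟨_, ⟨g, hg, rfl⟩, rfl⟩
    refine (RCLike.re_le_norm _).trans ?_
    simpa using g.le_of_opNorm_le (c := 1) (by simpa using hg) (A x)

/-- Along a weakly null tree the iterated upper limits are decreased branch by branch. -/
theorem exists_branch_lt (A : X →L[𝕜] Y) {D : Type*} [Preorder D] [IsDirectedOrder D] [Nonempty D]
    {n : ℕ} {x : List D → X} (hx : IsWeaklyNullTree 𝕜 n x) {c : ℝ≥0∞}
    (h : iterLimsup A n 0 < c) (k : ℕ) (hk : k ≤ n) :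
    ∃ t : List D, t.length = k ∧
      iterLimsup A (n - k) (∑ i ∈ Finset.range k, x (t.take (i + 1))) < c := by
  induction k with
  | zero => exact ⟨[], rfl, by simpa using h⟩
  | succ k ih =>
    obtain ⟨t, ht, hlt⟩ := ih (by omega)
    obtain ⟨m, hm⟩ : ∃ m, n - k = m + 1 := ⟨n - k - 1, by omega⟩
    rw [hm, iterLimsup_succ] at hlt
    have htend : Tendsto (fun d : D => x (t ++ [d])) atTop (weakNull 𝕜 X) := by
      refine tendsto_weakNull_iff.2 ⟨tendsto_toWeakSpace_zero_iff.1 (hx.2 t (by omega)),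
        Eventually.of_forall fun d => hx.1 _ (by simp) (by simp; omega)⟩
    obtain ⟨d, hd⟩ := (htend.eventually (eventually_lt_of_limsup_lt hlt)).exists
    refine ⟨t ++ [d], by simp [ht], ?_⟩
    rw [show n - (k + 1) = m by omega, Finset.sum_range_succ]
    convert hd using 3
    · refine Finset.sum_congr rfl fun i hi => ?_
      rw [List.take_append_of_le_length (by have := Finset.mem_range.1 hi; omega)]
    · rw [List.take_of_length_le (by simp [ht])]

section TreeConstruction

variable (A : X →L[𝕜] Y) (c : ℝ≥0∞)

open Classical in
/-- A point of the member `d` of the filter of weakly null points whose addition to `z` keeps the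
`k`-fold iterated upper limit above `c`, and `0` if there is none. -/
noncomputable def pick (k : ℕ) (z : X) (d : Set X) : X :=
  if h : ∃ x ∈ d ∩ Metric.closedBall 0 1, c < iterLimsup A k (z + x) then h.choose else 0

theorem pick_mem (k : ℕ) (z : X) {d : Set X} (hd : d ∈ weakNull 𝕜 X) :
    pick A c k z d ∈ d ∩ Metric.closedBall 0 1 := by
  unfold pick
  split_ifs with h
  · exact h.choose_spec.1
  · exact ⟨zero_mem_of_mem_weakNull 𝕜 hd, by simp⟩

theorem lt_iterLimsup_add_pick {k : ℕ} {z : X} {d : Set X} (hd : d ∈ weakNull 𝕜 X)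
    (h : c < iterLimsup A (k + 1) z) : c < iterLimsup A k (z + pick A c k z d) := by
  have h' : ∃ x ∈ d ∩ Metric.closedBall 0 1, c < iterLimsup A k (z + x) := by
    obtain ⟨x, hx, hxd, hx1⟩ := ((frequently_lt_of_lt_limsup (by isBoundedDefault) h).and_eventually
      ((show ∀ᶠ x in weakNull 𝕜 X, x ∈ d from hd).and (eventually_weakNull_norm_le 𝕜))).exists
    exact ⟨x, ⟨hxd, by simpa using hx1⟩, hx⟩
  unfold pick
  rw [dif_pos h']
  exact h'.choose_spec.2

/-- The partial sums along the branches of the tree of height `n` built by successive use of `pick`;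
branches are listed from their end to their root. -/
noncomputable def pickSum (n : ℕ) : List (Set X) → X
  | [] => 0
  | d :: t => pickSum n t + pick A c (n - (t.length + 1)) (pickSum n t) d

/-- The nodes of the tree whose branch sums are `pickSum`. It is indexed by the members of `weakNull`
ordered by reverse inclusion, a directed set in the universe of `X`. -/
noncomputable def pickTree (n : ℕ) (t : List ((weakNull 𝕜 X).setsᵒᵈ)) : X :=
  match (t.map fun d => ((OrderDual.ofDual d : (weakNull 𝕜 X).sets) : Set X)).reverse with
  | [] => 0
  | d :: r => pick A c (n - (r.length + 1)) (pickSum A c n r) d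

theorem pickTree_append (n : ℕ) (t : List ((weakNull 𝕜 X).setsᵒᵈ)) (d : (weakNull 𝕜 X).setsᵒᵈ) :
    pickTree A c n (t ++ [d]) = pick A c (n - (t.length + 1))
      (pickSum A c n (t.map fun d => ((OrderDual.ofDual d : (weakNull 𝕜 X).sets) : Set X)).reverse)
      (OrderDual.ofDual d : (weakNull 𝕜 X).sets) := by
  simp [pickTree]

instance isDirectedOrder_sets_orderDual {α : Type*} (l : Filter α) : IsDirectedOrder (l.setsᵒᵈ) :=
  ⟨fun a b => ⟨OrderDual.toDual ⟨_, inter_mem (OrderDual.ofDual a).2 (OrderDual.ofDual b).2⟩,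
    fun _ h => h.1, fun _ h => h.2⟩⟩

theorem isWeaklyNullTree_pickTree (n : ℕ) : IsWeaklyNullTree 𝕜 n (pickTree A c n) := by
  refine ⟨fun t ht _ => ?_, fun t _ => ?_⟩
  · obtain ⟨r, d, rfl⟩ : ∃ r d, t = r ++ [d] :=
      ⟨t.dropLast, t.getLast (List.ne_nil_of_length_pos ht), (List.dropLast_append_getLast _).symm⟩
    rw [pickTree_append]
    simpa using (pick_mem A c _ _ (OrderDual.ofDual d).2).2
  · refine tendsto_toWeakSpace_zero_iff.2 fun f => ?_
    refine fun U hU => ?_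
    have hU' := tendsto_eval_weakNull f hU
    refine mem_map.2 (mem_of_superset (Ici_mem_atTop (OrderDual.toDual ⟨_, hU'⟩)) fun d hd => ?_)
    rw [Set.mem_preimage, pickTree_append]
    exact hd (pick_mem A c _ _ (OrderDual.ofDual d).2).1

theorem sum_pickTree (n : ℕ) (t : List ((weakNull 𝕜 X).setsᵒᵈ)) :
    ∑ i ∈ Finset.range t.length, pickTree A c n (t.take (i + 1)) = pickSum A c n
      (t.map fun d => ((OrderDual.ofDual d : (weakNull 𝕜 X).sets) : Set X)).reverse := by
  induction t using List.reverseRecOn with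
  | nil => simp [pickSum]
  | append_singleton t d ih =>
    rw [List.length_append, List.length_singleton, Finset.sum_range_succ,
      List.take_of_length_le (by simp), pickTree_append]
    simp only [List.map_append, List.map_cons, List.map_nil, List.reverse_append,
      List.reverse_cons, List.reverse_nil, List.nil_append, List.cons_append, pickSum,
      List.length_reverse, List.length_map]
    rw [← ih]
    congr 1
    refine Finset.sum_congr rfl fun i hi => ?_
    rw [List.take_append_of_le_length (by have := Finset.mem_range.1 hi; omega)]

theorem lt_iterLimsup_pickSum {n : ℕ} (h : c < iterLimsup A n 0) (t : List (Set X))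
    (ht : ∀ d ∈ t, d ∈ weakNull 𝕜 X) (htn : t.length ≤ n) :
    c < iterLimsup A (n - t.length) (pickSum A c n t) := by
  induction t with
  | nil => simpa [pickSum] using h
  | cons d t ih =>
    rw [List.length_cons] at htn ⊢
    have := ih (fun d hd => ht d (List.mem_cons_of_mem _ hd)) (by omega)
    rw [show n - t.length = n - (t.length + 1) + 1 by omega] at this
    exact lt_iterLimsup_add_pick A c (ht d List.mem_cons_self) this

end TreeConstruction

/-- `Σₙ(A)` is the `n`-fold iterated upper limit of `‖A (x₁ + ⋯ + xₙ)‖` over weakly null points of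
the unit ball. Trees over arbitrary directed sets give no more than the single tree indexed by
the weak neighbourhoods of `0`. -/
theorem opSigmaN_eq_iterLimsup (n : ℕ) (A : X →L[𝕜] Y) : opSigmaN n A = iterLimsup A n 0 := by
  unfold opSigmaN sigmaN
  simp only [supportFn_adjointBall]
  have hbdd : ∀ {D : Type u} (x : List D → X),
      BddBelow (Set.range fun t : List.Vector D n => ‖A (branchSum x t)‖) :=
    fun x => ⟨0, by rintro _ ⟨t, rfl⟩; exact norm_nonneg _⟩
  refine le_antisymm (le_of_forall_gt fun c hc => ?_) (le_sInf ?_)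
  · obtain ⟨s, hs, hsc⟩ := ENNReal.lt_iff_exists_nnreal_btwn.1 hc
    refine lt_of_le_of_lt (sInf_le ⟨s, ?_, (ENNReal.ofReal_coe_nnreal).symm, ?_⟩) hsc
    · exact_mod_cast (zero_le).trans_lt hs
    · intro D _ _ _ x hx
      obtain ⟨t, ht, hlt⟩ := exists_branch_lt A hx hs n le_rfl
      refine (ciInf_le (hbdd x) ⟨t, ht⟩).trans ?_
      rw [Nat.sub_self, iterLimsup_zero] at hlt
      have : (‖A (∑ i ∈ Finset.range n, x (t.take (i + 1)))‖₊ : ℝ≥0∞) < s := hlt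
      exact_mod_cast this.le
  · rintro _ ⟨s, hs, rfl, H⟩
    by_contra! hlt
    obtain ⟨c, hc, hclt⟩ := ENNReal.lt_iff_exists_nnreal_btwn.1 hlt
    have hsc : s < c := by
      rwa [← ENNReal.ofReal_coe_nnreal, ENNReal.ofReal_lt_ofReal_iff_of_nonneg hs.le] at hc
    have : Nonempty ((weakNull 𝕜 X).setsᵒᵈ) := ⟨OrderDual.toDual ⟨Set.univ, univ_mem⟩⟩
    have : Nonempty (List.Vector ((weakNull 𝕜 X).setsᵒᵈ) n) :=
      ⟨List.Vector.replicate n (Classical.arbitrary _)⟩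
    refine (hsc.trans_le (le_ciInf fun t => ?_)).not_ge
      (H _ (pickTree A c n) (isWeaklyNullTree_pickTree A c n))
    obtain ⟨t, rfl⟩ := t
    have := lt_iterLimsup_pickSum A c hclt
      (t.map fun d => ((OrderDual.ofDual d : (weakNull 𝕜 X).sets) : Set X)).reverse
      (by simpa using fun d hd _ => hd) (by simp)
    rw [← sum_pickTree] at this
    simp only [List.length_reverse, List.length_map, Nat.sub_self, iterLimsup_zero] at this
    exact_mod_cast this.le

theorem opSigma_eq_iSup (A : X →L[𝕜] Y) : opSigma A = ⨆ n, iterLimsup A n 0 := by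
  refine le_antisymm (iSup₂_le fun n _ => ?_) (iSup_le fun n => ?_)
  · exact (opSigmaN_eq_iterLimsup n A).trans_le (le_iSup (fun n => iterLimsup A n 0) n)
  · refine (le_iterLimsup_succ A n 0).trans ?_
    rw [← opSigmaN_eq_iterLimsup]
    exact le_iSup₂ (f := fun (n : ℕ) (_ : 1 ≤ n) => sigmaN n (adjointBall A)) (n + 1) (by omega)

theorem iterLimsup_le_opSigma (A : X →L[𝕜] Y) (n : ℕ) : iterLimsup A n 0 ≤ opSigma A :=
  (opSigma_eq_iSup A).symm ▸ le_iSup (fun n => iterLimsup A n 0) n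

end IterLimsup

/-! ### Summable Szlenk index and iterated upper limits -/

section SummableIndex

variable {𝕜 : Type w} [RCLike 𝕜] {X : Type u} [NormedAddCommGroup X] [NormedSpace 𝕜 X]
  {Y : Type v} [NormedAddCommGroup Y] [NormedSpace 𝕜 Y]

theorem szlenkDeriv_subset (ε : ℝ) (K : Set (StrongDual 𝕜 X)) : szlenkDeriv ε K ⊆ K := by
  unfold szlenkDeriv
  split_ifs
  exacts [subset_rfl, Set.sep_subset _ _]

theorem foldr_szlenkDeriv_subset (l : List ℝ) (K : Set (StrongDual 𝕜 X)) :
    l.foldr szlenkDeriv K ⊆ K := by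
  induction l with
  | nil => exact subset_rfl
  | cons ε l ih => exact (szlenkDeriv_subset _ _).trans ih

theorem isCompact_szlenkDeriv (ε : ℝ) {K : Set (StrongDual 𝕜 X)}
    (hK : IsCompact (StrongDual.toWeakDual '' K)) :
    IsCompact (StrongDual.toWeakDual '' szlenkDeriv ε K) := by
  unfold szlenkDeriv
  split_ifs with hε
  · exact hK
  · let C : Set (WeakDual 𝕜 X) := {f | ∀ V ∈ 𝓝 f,
      ENNReal.ofReal ε < Metric.ediam ((StrongDual.toWeakDual ⁻¹' V) ∩ K)}
    have hC : IsClosed C := by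
      refine ⟨isOpen_iff_mem_nhds.2 fun f hf => ?_⟩
      have hf' : ¬ ∀ V ∈ 𝓝 f,
        ENNReal.ofReal ε < Metric.ediam ((StrongDual.toWeakDual ⁻¹' V) ∩ K) := hf
      push Not at hf'
      obtain ⟨V, hV, hle⟩ := hf'
      filter_upwards [eventually_mem_nhds_iff.2 hV] with g hg hgC
      exact (hgC V hg).not_ge hle
    convert hK.inter_right hC using 1
    ext f
    constructor
    · rintro ⟨g, ⟨hg, hgV⟩, rfl⟩
      exact ⟨⟨g, hg, rfl⟩, hgV⟩
    · rintro ⟨⟨g, hg, rfl⟩, hgV⟩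
      exact ⟨g, ⟨hg, hgV⟩, rfl⟩

theorem isCompact_foldr_szlenkDeriv (l : List ℝ) {K : Set (StrongDual 𝕜 X)}
    (hK : IsCompact (StrongDual.toWeakDual '' K)) :
    IsCompact (StrongDual.toWeakDual '' l.foldr szlenkDeriv K) := by
  induction l with
  | nil => exact hK
  | cons ε l ih => exact isCompact_szlenkDeriv ε ih

theorem isCompact_adjointBall (A : X →L[𝕜] Y) :
    IsCompact (StrongDual.toWeakDual '' adjointBall A) := by
  let T : WeakDual 𝕜 Y → WeakDual 𝕜 X := fun g =>
    StrongDual.toWeakDual ((WeakDual.toStrongDual g).comp A)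
  have hT : Continuous T :=
    WeakDual.continuous_of_continuous_eval fun x => WeakDual.eval_continuous (A x)
  convert (WeakDual.isCompact_closedBall (0 : StrongDual 𝕜 Y) 1).image hT using 1
  ext f
  constructor
  · rintro ⟨_, ⟨g, hg, rfl⟩, rfl⟩
    exact ⟨StrongDual.toWeakDual g, hg, rfl⟩
  · rintro ⟨g, hg, rfl⟩
    exact ⟨_, ⟨WeakDual.toStrongDual g, hg, rfl⟩, rfl⟩

theorem norm_apply_le_of_mem_adjointBall {A : X →L[𝕜] Y} {f : StrongDual 𝕜 X}
    (hf : f ∈ adjointBall A) {x : X} (hx : ‖x‖ ≤ 1) : ‖f x‖ ≤ ‖A‖ := by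
  obtain ⟨g, hg, rfl⟩ := hf
  have h1 : ‖g (A x)‖ ≤ 1 * ‖A x‖ := g.le_of_opNorm_le (by simpa using hg) _
  have h2 : ‖A x‖ ≤ ‖A‖ := A.unit_le_opNorm x hx
  simpa using h1.trans (by linarith)

/-- If functionals of `L` converge weak* to `f ∈ L` along a weakly null net on which their values
converge to a number greater than `ε`, then `f` lies in the derived set `s_ε(L)`. -/
theorem mem_szlenkDeriv_of_tendsto {L : Set (StrongDual 𝕜 X)} {l : Filter X} [l.NeBot]
    (hl : l ≤ weakNull 𝕜 X) {φ : X → StrongDual 𝕜 X} (hφL : ∀ᶠ x in l, φ x ∈ L)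
    {f : StrongDual 𝕜 X} (hf : f ∈ L)
    (hφ : Tendsto (fun x => StrongDual.toWeakDual (φ x)) l (𝓝 (StrongDual.toWeakDual f)))
    {b ε : ℝ} (hb : Tendsto (fun x => RCLike.re (φ x x)) l (𝓝 b)) (hε : ε < b) :
    f ∈ szlenkDeriv ε L := by
  unfold szlenkDeriv
  split_ifs with h0
  · exact hf
  refine ⟨hf, fun V hV => ?_⟩
  have hfx : Tendsto (fun x => RCLike.re (f x)) l (𝓝 0) :=
    (tendsto_re_eval_weakNull f).mono_left hl
  have hsub := hb.sub hfx
  rw [sub_zero] at hsub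
  obtain ⟨x, hxL, hxV, hxε, hx1⟩ := (hφL.and ((hφ.eventually_mem hV).and
    ((hsub.eventually (lt_mem_nhds hε)).and (hl (eventually_weakNull_norm_le 𝕜))))).exists
  have hlt : ε < ‖φ x - f‖ := by
    have h1 : RCLike.re ((φ x - f) x) ≤ ‖φ x - f‖ :=
      (RCLike.re_le_norm _).trans ((φ x - f).unit_le_opNorm x hx1)
    rw [sub_apply, map_sub] at h1
    linarith
  have hfV : StrongDual.toWeakDual f ∈ V := mem_of_mem_nhds hV
  refine lt_of_lt_of_le ?_ (Metric.edist_le_ediam_of_mem (x := φ x) (y := f)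
    ⟨hxV, hxL⟩ ⟨hfV, hf⟩)
  rw [edist_dist, dist_eq_norm]
  exact (ENNReal.ofReal_lt_ofReal_iff_of_nonneg (not_le.1 h0).le).2 hlt

/-- A bounded interval is approximated strictly from below by a finite set. -/
theorem exists_finite_grid (C : ℝ) {δ : ℝ} (hδ : 0 < δ) :
    ∃ G : Set ℝ, G.Finite ∧ ∀ b ∈ Set.Icc (-C) C, ∃ g ∈ G, b - δ < g ∧ g < b := by
  obtain ⟨t, -, ht, hcov⟩ := (isCompact_Icc (a := -C) (b := C)).finite_cover_balls (half_pos hδ)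
  refine ⟨(fun x => x - δ / 2) '' t, ht.image _, fun b hb => ?_⟩
  obtain ⟨x, hx, hbx⟩ := Set.mem_iUnion₂.1 (hcov hb)
  rw [Metric.mem_ball, Real.dist_eq, abs_lt] at hbx
  exact ⟨_, ⟨x, hx, rfl⟩, by simp only; linarith, by simp only; linarith⟩

/-- A lower bound for the iterated upper limits gives points of derived sets. The increments are
taken from a finite grid, so that only finitely many lists occur for each `n`; one of them then
serves for frequently many weakly null points, and weak* cluster points can be taken. -/
theorem exists_mem_foldr_szlenkDeriv (A : X →L[𝕜] Y) {δ : ℝ} (hδ : 0 < δ) (n : ℕ) :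
    ∃ S : Set (List ℝ), S.Finite ∧ ∀ (z : X) (a : ℝ), ENNReal.ofReal a < iterLimsup A n z →
      ∃ l ∈ S, ∃ f ∈ l.foldr szlenkDeriv (adjointBall A), a - n * δ < RCLike.re (f z) + l.sum := by
  obtain ⟨G, hG, hgrid⟩ := exists_finite_grid ‖A‖ hδ
  induction n with
  | zero =>
    refine ⟨{[]}, Set.finite_singleton _, fun z a ha => ⟨[], rfl, ?_⟩⟩
    obtain ⟨g, hg, hgz⟩ := exists_dual_vector'' 𝕜 (A z)
    refine ⟨g.comp A, ⟨g, by simpa using hg, rfl⟩, ?_⟩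
    rw [iterLimsup_zero, ← ofReal_norm, ENNReal.ofReal_lt_ofReal_iff'] at ha
    simpa [hgz] using ha.1
  | succ n ih =>
    obtain ⟨S, hS, H⟩ := ih
    refine ⟨Set.image2 List.cons G S, hG.image2 _ hS, fun z a ha => ?_⟩
    rw [iterLimsup_succ] at ha
    have hfreq : ∃ᶠ x in weakNull 𝕜 X, ∃ l ∈ S, ∃ f ∈ l.foldr szlenkDeriv (adjointBall A),
        a - n * δ < RCLike.re (f (z + x)) + l.sum :=
      (frequently_lt_of_lt_limsup (by isBoundedDefault) ha).mono fun x hx => H _ _ hx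
    let T : Set X := {x | ∃ l ∈ S, ∃ f ∈ l.foldr szlenkDeriv (adjointBall A),
      a - n * δ < RCLike.re (f (z + x)) + l.sum}
    have : (weakNull 𝕜 X ⊓ 𝓟 T).NeBot := frequently_mem_iff_neBot.1 hfreq
    let 𝓤 := Ultrafilter.of (weakNull 𝕜 X ⊓ 𝓟 T)
    have h𝓤 : (𝓤 : Filter X) ≤ weakNull 𝕜 X ⊓ 𝓟 T := Ultrafilter.of_le _
    have h𝓤null : (𝓤 : Filter X) ≤ weakNull 𝕜 X := h𝓤.trans inf_le_left
    obtain ⟨l, hl, hlU⟩ : ∃ l ∈ S, ∀ᶠ x in (𝓤 : Filter X),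
        ∃ f ∈ l.foldr szlenkDeriv (adjointBall A), a - n * δ < RCLike.re (f (z + x)) + l.sum := by
      refine (Ultrafilter.finite_biUnion_mem_iff hS).1 ?_
      filter_upwards [h𝓤 (mem_inf_of_right (mem_principal_self _))] with x hx
      obtain ⟨l, hl, hlx⟩ := hx
      exact Set.mem_biUnion hl hlx
    obtain ⟨φ, hφ⟩ := hlU.choice
    set L := l.foldr szlenkDeriv (adjointBall A) with hL
    obtain ⟨_, ⟨f, hf, rfl⟩, hlim⟩ := (isCompact_foldr_szlenkDeriv l
      (isCompact_adjointBall A)).ultrafilter_le_nhds (𝓤.map fun x => StrongDual.toWeakDual (φ x))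
      (le_principal_iff.2 (mem_map.2 (hφ.mono fun x hx => ⟨_, hx.1, rfl⟩)))
    have hlim' : Tendsto (fun x => StrongDual.toWeakDual (φ x)) 𝓤
      (𝓝 (StrongDual.toWeakDual f)) := hlim
    obtain ⟨b, hb, hblim⟩ := (isCompact_Icc (a := -‖A‖) (b := ‖A‖)).ultrafilter_le_nhds
      (𝓤.map fun x => RCLike.re (φ x x)) (by
        refine le_principal_iff.2 (mem_map.2 ?_)
        filter_upwards [hφ, h𝓤null (eventually_weakNull_norm_le 𝕜)] with x hx hx1
        exact abs_le.1 ((RCLike.abs_re_le_norm _).trans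
          (norm_apply_le_of_mem_adjointBall (foldr_szlenkDeriv_subset _ _ hx.1) hx1)))
    have hblim' : Tendsto (fun x => RCLike.re (φ x x)) 𝓤 (𝓝 b) := hblim
    obtain ⟨ε, hε, hεb, hbε⟩ := hgrid b hb
    refine ⟨ε :: l, Set.mem_image2_of_mem hε hl, f,
      mem_szlenkDeriv_of_tendsto h𝓤null (hφ.mono fun x hx => hx.1) hf hlim' hblim' hbε, ?_⟩
    have hz : Tendsto (fun x => RCLike.re (φ x z)) 𝓤 (𝓝 (RCLike.re (f z))) :=
      (RCLike.continuous_re.tendsto _).comp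
        (((WeakDual.eval_continuous z).tendsto _).comp hlim')
    have hge : a - n * δ ≤ RCLike.re (f z) + b + l.sum := by
      refine ge_of_tendsto ((hz.add hblim').add_const l.sum) (hφ.mono fun x hx => ?_)
      have := hx.2
      rw [map_add, map_add] at this
      exact this.le
    rw [List.sum_cons]
    push_cast
    linarith

theorem iterLimsup_le_of_isSummableWith {A : X →L[𝕜] Y} {M : ℝ}
    (hM : IsSummableWith M (adjointBall A)) (n : ℕ) : iterLimsup A n 0 ≤ ENNReal.ofReal M := by
  by_contra! h
  obtain ⟨c, hc, hlt⟩ := ENNReal.lt_iff_exists_nnreal_btwn.1 h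
  have hMc : M < c := by
    rw [← ENNReal.ofReal_coe_nnreal, ENNReal.ofReal_lt_ofReal_iff'] at hc
    exact hc.1
  obtain ⟨S, -, H⟩ := exists_mem_foldr_szlenkDeriv A
    (show 0 < (c - M) / (n + 1) by have := sub_pos.2 hMc; positivity) n
  obtain ⟨l, -, f, hf, hlt'⟩ := H 0 c (by rwa [ENNReal.ofReal_coe_nnreal])
  have hl : l.sum ≤ M := hM l ⟨f, hf⟩
  have : n * ((c - M) / (n + 1)) ≤ c - M := by
    rw [mul_div_assoc', div_le_iff₀ (by positivity)]
    nlinarith [sub_pos.2 hMc]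
  rw [map_zero, map_zero] at hlt'
  linarith

/-- A point `f` of `s_ε(L)` has functionals `g ∈ L` weak*-close to it which exceed it by almost
`ε / 4` at weakly null points: `g - f` is norming up to `ε / 2` at points `x_g` of the unit ball,
and halved differences of these points are weakly null. -/
theorem frequently_exists_of_mem_szlenkDeriv {L : Set (StrongDual 𝕜 X)} {ε : ℝ} (hε : 0 < ε)
    {f : StrongDual 𝕜 X} (hf : f ∈ szlenkDeriv ε L) (z : X) {δ : ℝ} (hδ : 0 < δ) :
    ∃ᶠ x in weakNull 𝕜 X, ∃ g ∈ L, RCLike.re (f z) + ε / 4 - δ < RCLike.re (g (z + x)) := by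
  rw [szlenkDeriv, if_neg hε.not_ge] at hf
  let S : Set (StrongDual 𝕜 X) := {g | g ∈ L ∧ ε / 2 < ‖g - f‖}
  have hS : ∃ᶠ g in comap StrongDual.toWeakDual (𝓝 (StrongDual.toWeakDual f)), g ∈ S := by
    intro hS
    obtain ⟨V, hV, hVS⟩ := hS
    refine (hf.2 V hV).not_ge (Metric.ediam_le fun g hg h hh => ?_)
    have h1 : ‖g - f‖ ≤ ε / 2 := not_lt.1 fun hlt => hVS hg.1 ⟨hg.2, hlt⟩
    have h2 : ‖h - f‖ ≤ ε / 2 := not_lt.1 fun hlt => hVS hh.1 ⟨hh.2, hlt⟩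
    rw [edist_dist, dist_eq_norm]
    refine ENNReal.ofReal_le_ofReal ?_
    calc ‖g - h‖ = ‖(g - f) - (h - f)‖ := by rw [sub_sub_sub_cancel_right]
      _ ≤ _ := norm_sub_le _ _
      _ ≤ ε := by linarith
  have := frequently_mem_iff_neBot.1 hS
  let 𝓤 := Ultrafilter.of (comap StrongDual.toWeakDual (𝓝 (StrongDual.toWeakDual f)) ⊓ 𝓟 S)
  have h𝓤 := Ultrafilter.of_le (comap StrongDual.toWeakDual (𝓝 (StrongDual.toWeakDual f)) ⊓ 𝓟 S)
  have hlim (y : X) : Tendsto (fun g : StrongDual 𝕜 X => RCLike.re ((g - f) y)) 𝓤 (𝓝 0) := by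
    have h1 : Tendsto (fun g : StrongDual 𝕜 X => StrongDual.toWeakDual g) 𝓤
      (𝓝 (StrongDual.toWeakDual f)) := tendsto_iff_comap.2 (h𝓤.trans inf_le_left)
    have h2 : Tendsto (fun g : StrongDual 𝕜 X => g y) 𝓤 (𝓝 (f y)) :=
      ((WeakDual.eval_continuous y).tendsto _).comp h1
    have h3 := (RCLike.continuous_re.tendsto _).comp (h2.sub_const (f y))
    rwa [sub_self, map_zero] at h3
  have hnorming (g : StrongDual 𝕜 X) :
      ∃ x : X, ‖x‖ ≤ 1 ∧ (g ∈ S → ε / 2 < RCLike.re ((g - f) x)) := by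
    by_cases hg : g ∈ S
    · obtain ⟨x, hx, hlt⟩ := (g - f).exists_lt_apply_of_lt_opNorm hg.2
      -- multiply by a unimodular scalar to make the value of the functional a nonnegative real
      obtain ⟨c, hc, hcx⟩ := RCLike.exists_norm_eq_mul_self ((g - f) x)
      refine ⟨c • x, by rw [norm_smul, hc, one_mul]; exact hx.le, fun _ => ?_⟩
      rwa [map_smul, smul_eq_mul, ← hcx, RCLike.ofReal_re]
    · exact ⟨0, by simp, fun h => (hg h).elim⟩
  choose x hx1 hx using hnorming
  have hdiff := tendsto_half_sub_weakNull (𝕜 := 𝕜) 𝓤 x hx1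
  refine fun hev => ?_
  have hfz : ∀ᶠ y in weakNull 𝕜 X, -(δ / 4) < RCLike.re (f y) :=
    (tendsto_re_eval_weakNull f).eventually (lt_mem_nhds (by linarith))
  -- first a functional `g'` is fixed, then `g` is chosen so close to `f` that `g - f` is small at
  -- `z` and at the point attached to `g'`
  obtain ⟨g', hg'⟩ := (hdiff.eventually (hev.and hfz)).curry.exists
  have hS𝓤 : ∀ᶠ g in (𝓤 : Filter (StrongDual 𝕜 X)), g ∈ S :=
    h𝓤 (mem_inf_of_right (mem_principal_self S))
  obtain ⟨g, ⟨hg1, hg2⟩, hgS, hgz, hgx⟩ := (hg'.and (hS𝓤.and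
    (((hlim z).eventually (lt_mem_nhds (show -(δ / 4) < 0 by linarith))).and
      ((hlim (x g')).eventually (gt_mem_nhds (show 0 < δ / 4 by linarith)))))).exists
  refine hg1 ⟨g, hgS.1, ?_⟩
  simp only at hg2
  set y := (2⁻¹ : 𝕜) • (x g - x g') with hy
  have h1 := hx g hgS
  have h2 : RCLike.re ((g - f) y) = 2⁻¹ * (RCLike.re ((g - f) (x g)) -
      RCLike.re ((g - f) (x g'))) := by
    rw [hy, map_smul, smul_eq_mul, ← map_sub, ← map_sub, ← RCLike.re_ofReal_mul]
    push_cast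
    rfl
  have h3 : RCLike.re (g (z + y)) = RCLike.re (f z) + RCLike.re ((g - f) z) + RCLike.re (f y) +
      RCLike.re ((g - f) y) := by
    simp only [sub_apply, map_add, map_sub]
    ring
  linarith

/-- Points of derived sets give lower bounds for the iterated upper limits. Each derivation with
`ε ≤ 0` is trivial and may be matched by the weakly null point `0`. -/
theorem ofReal_le_iterLimsup_of_mem (A : X →L[𝕜] Y) (l : List ℝ) {f : StrongDual 𝕜 X}
    (hf : f ∈ l.foldr szlenkDeriv (adjointBall A)) (z : X) :
    ENNReal.ofReal (RCLike.re (f z) + l.sum / 4) ≤ iterLimsup A l.length z := by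
  induction l generalizing f z with
  | nil =>
    rw [List.length_nil, iterLimsup_zero, ← ofReal_norm, ← supportFn_adjointBall]
    refine ENNReal.ofReal_le_ofReal ?_
    obtain ⟨g, hg, rfl⟩ := hf
    rw [supportFn_adjointBall, List.sum_nil, zero_div, add_zero]
    refine (RCLike.re_le_norm _).trans ?_
    simpa using g.le_of_opNorm_le (c := 1) (by simpa using hg) (A z)
  | cons ε l ih =>
    rw [List.length_cons, List.sum_cons]
    rcases le_or_gt ε 0 with hε | hε
    · rw [List.foldr_cons, szlenkDeriv, if_pos hε] at hf
      refine le_trans (ENNReal.ofReal_le_ofReal ?_) ((ih hf z).trans (le_iterLimsup_succ A _ z))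
      linarith
    · have key (δ : ℝ) (hδ : 0 < δ) :
          ENNReal.ofReal (RCLike.re (f z) + ε / 4 - δ + l.sum / 4) ≤
            iterLimsup A (l.length + 1) z := by
        refine le_limsup_of_frequently_le' ?_
        refine (frequently_exists_of_mem_szlenkDeriv hε hf z hδ).mono ?_
        rintro x ⟨g, hg, hlt⟩
        exact (ENNReal.ofReal_le_ofReal (by linarith)).trans (ih hg (z + x))
      have hlim : Tendsto (fun δ : ℝ => ENNReal.ofReal (RCLike.re (f z) + ε / 4 - δ + l.sum / 4))
          (𝓝[>] 0) (𝓝 (ENNReal.ofReal (RCLike.re (f z) + (ε + l.sum) / 4))) := by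
        refine (Continuous.tendsto' (ENNReal.continuous_ofReal.comp (by fun_prop)) _ _ ?_).mono_left nhdsWithin_le_nhds
        rw [Function.comp_apply, sub_zero, add_assoc, ← add_div]
      exact le_of_tendsto hlim (eventually_nhdsWithin_of_forall key)

/-- An operator has summable Szlenk index if and only if `Σ(A)` is finite. -/
theorem hasSummableIndex_iff (A : X →L[𝕜] Y) : HasSummableIndex A ↔ opSigma A ≠ ∞ := by
  constructor
  · rintro ⟨M, -, hM⟩
    rw [opSigma_eq_iSup]
    exact ((iSup_le fun n => iterLimsup_le_of_isSummableWith hM n).trans_lt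
      ENNReal.ofReal_lt_top).ne
  · intro h
    refine ⟨4 * (opSigma A).toReal, by positivity, fun l hl => ?_⟩
    obtain ⟨f, hf⟩ := hl
    have := (ofReal_le_iterLimsup_of_mem A l hf 0).trans (iterLimsup_le_opSigma A _)
    rw [map_zero, map_zero, zero_add, ENNReal.ofReal_le_iff_le_toReal h] at this
    linarith

end SummableIndex

/-! ### The norm of `ℓ_p` on families in `[0, ∞]` -/

section EllNorm

variable {ι : Type*} {p : ℝ≥0∞}

theorem ellNorm_top (a : ι → ℝ≥0∞) : ellNorm ∞ a = ⨆ i, a i := if_pos rfl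

theorem ellNorm_of_ne_top (hp : p ≠ ∞) (a : ι → ℝ≥0∞) :
    ellNorm p a = (∑' i, a i ^ p.toReal) ^ (1 / p.toReal) := if_neg hp

theorem ellNorm_mono (p : ℝ≥0∞) {a b : ι → ℝ≥0∞} (h : ∀ i, a i ≤ b i) :
    ellNorm p a ≤ ellNorm p b := by
  unfold ellNorm
  split_ifs
  · exact iSup_mono h
  · gcongr with i
    exact h i

theorem toReal_exponent_pos (hp1 : 1 ≤ p) (hp : p ≠ ∞) : 0 < p.toReal :=
  ENNReal.toReal_pos (zero_lt_one.trans_le hp1).ne' hp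

theorem ellNorm_indicator_le (p : ℝ≥0∞) (s : Set ι) (a : ι → ℝ≥0∞) :
    ellNorm p (s.indicator a) ≤ ellNorm p a :=
  ellNorm_mono p fun i => Set.indicator_le_self s a i

theorem ellNorm_top_indicator (F : Finset ι) (a : ι → ℝ≥0∞) :
    ellNorm ∞ ((F : Set ι).indicator a) = F.sup a := by
  rw [ellNorm_top, Finset.sup_eq_iSup]
  refine le_antisymm (iSup_le fun i => ?_) (iSup₂_le fun i hi => ?_)
  · by_cases hi : i ∈ F
    · rw [Set.indicator_of_mem (by exact hi)]
      exact le_iSup₂ (f := fun i (_ : i ∈ F) => a i) i hi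
    · rw [Set.indicator_of_notMem (by exact hi)]
      exact zero_le
  · refine le_iSup_of_le i ?_
    rw [Set.indicator_of_mem (by exact hi)]

theorem ellNorm_indicator_of_ne_top (hp1 : 1 ≤ p) (hp : p ≠ ∞) (F : Finset ι) (a : ι → ℝ≥0∞) :
    ellNorm p ((F : Set ι).indicator a) = (∑ i ∈ F, a i ^ p.toReal) ^ (1 / p.toReal) := by
  rw [ellNorm_of_ne_top hp, tsum_eq_sum (s := F)]
  · congr 1
    exact Finset.sum_congr rfl fun i hi => by rw [Set.indicator_of_mem (by exact hi)]
  · intro i hi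
    rw [Set.indicator_of_notMem (by exact hi), ENNReal.zero_rpow_of_pos (toReal_exponent_pos hp1 hp)]

theorem continuous_ellNorm_indicator (hp1 : 1 ≤ p) (F : Finset ι) :
    Continuous fun a : ι → ℝ≥0∞ => ellNorm p ((F : Set ι).indicator a) := by
  by_cases hp : p = ∞
  · subst hp
    simp_rw [ellNorm_top_indicator]
    exact Continuous.finset_sup_apply fun i _ => continuous_apply i
  · simp_rw [ellNorm_indicator_of_ne_top hp1 hp]
    refine ENNReal.continuous_rpow_const.comp (continuous_finsetSum _ fun i _ => ?_)
    exact ENNReal.continuous_rpow_const.comp (continuous_apply i)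

theorem ellNorm_le_of_forall_finset (hp1 : 1 ≤ p) {a : ι → ℝ≥0∞} {c : ℝ≥0∞}
    (h : ∀ F : Finset ι, ellNorm p ((F : Set ι).indicator a) ≤ c) : ellNorm p a ≤ c := by
  by_cases hp : p = ∞
  · subst hp
    rw [ellNorm_top]
    refine iSup_le fun i => ?_
    have := h {i}
    rwa [ellNorm_top_indicator, Finset.sup_singleton] at this
  · have hq := toReal_exponent_pos hp1 hp
    rw [ellNorm_of_ne_top hp, one_div, ENNReal.rpow_inv_le_iff hq, ENNReal.tsum_eq_iSup_sum]
    refine iSup_le fun F => ?_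
    rw [← ENNReal.rpow_inv_le_iff hq, ← one_div, ← ellNorm_indicator_of_ne_top hp1 hp]
    exact h F

theorem ellNorm_ne_top_iff (hp1 : 1 ≤ p) (a : ι → ℝ≥0∞) :
    ellNorm p a ≠ ∞ ↔ (∀ i, a i ≠ ∞) ∧ Memℓp (fun i => (a i).toReal) p := by
  by_cases hp : p = ∞
  · subst hp
    rw [ellNorm_top, memℓp_infty_iff]
    constructor
    · intro h
      have hle (i : ι) : a i ≤ ⨆ i, a i := le_iSup a i
      refine ⟨fun i => ne_top_of_le_ne_top h (hle i), (⨆ i, a i).toReal, ?_⟩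
      rintro _ ⟨i, rfl⟩
      simpa using ENNReal.toReal_mono h (hle i)
    · rintro ⟨h, C, hC⟩
      refine ne_top_of_le_ne_top (ENNReal.ofReal_ne_top (r := C)) (iSup_le fun i => ?_)
      rw [← ENNReal.ofReal_toReal (h i)]
      exact ENNReal.ofReal_le_ofReal ((le_abs_self _).trans (hC ⟨i, rfl⟩))
  · have hq := toReal_exponent_pos hp1 hp
    rw [ellNorm_of_ne_top hp, memℓp_gen_iff hq, Ne, ENNReal.rpow_eq_top_iff_of_pos (by positivity)]
    have hterm (i : ι) : ‖(a i).toReal‖ ^ p.toReal = (a i ^ p.toReal).toReal := by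
      rw [Real.norm_of_nonneg ENNReal.toReal_nonneg, ENNReal.toReal_rpow]
    simp_rw [hterm]
    constructor
    · intro h
      refine ⟨fun i hi => ENNReal.ne_top_of_tsum_ne_top h i ?_, ENNReal.summable_toReal h⟩
      rw [hi, ENNReal.top_rpow_of_pos hq]
    · rintro ⟨h, hs⟩
      have := hs.tsum_ofReal_ne_top
      convert this using 4 with i
      rw [ENNReal.ofReal_toReal (ENNReal.rpow_ne_top_of_nonneg hq.le (h i))]

theorem enorm_lp_eq_ellNorm [Fact (1 ≤ p)] {E : ι → Type*} [∀ i, NormedAddCommGroup (E i)]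
    (x : lp E p) : ‖x‖ₑ = ellNorm p fun i => ‖x i‖ₑ := by
  have hp1 : 1 ≤ p := Fact.out
  by_cases hp : p = ∞
  · subst hp
    rw [ellNorm_top]
    have hle (i : ι) : ‖x i‖ₑ ≤ ‖x‖ₑ :=
      enorm_le_iff_norm_le.2 (lp.norm_apply_le_norm ENNReal.top_ne_zero x i)
    refine le_antisymm ?_ (iSup_le hle)
    have hne : (⨆ i, ‖x i‖ₑ) ≠ ∞ := ne_top_of_le_ne_top enorm_ne_top (iSup_le hle)
    rw [← ofReal_norm, ENNReal.ofReal_le_iff_le_toReal hne]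
    refine lp.norm_le_of_forall_le ENNReal.toReal_nonneg fun i => ?_
    rw [← toReal_enorm]
    exact ENNReal.toReal_mono hne (le_iSup (fun i => ‖x i‖ₑ) i)
  · have hq := toReal_exponent_pos hp1 hp
    rw [ellNorm_of_ne_top hp, ← ofReal_norm, lp.norm_eq_tsum_rpow hq,
      ← ENNReal.ofReal_rpow_of_nonneg (tsum_nonneg fun i => by positivity) (by positivity),
      ENNReal.ofReal_tsum_of_nonneg (fun i => by positivity) ((lp.memℓp x).summable hq)]
    congr 2
    ext i
    rw [← ofReal_norm, ENNReal.ofReal_rpow_of_nonneg (norm_nonneg _) hq.le]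

end EllNorm

/-! ### Iterated upper limits for diagonal operators -/

section DirectSum

variable {𝕜 : Type w} [RCLike 𝕜] {ι : Type*} {X : ι → Type u} {Y : ι → Type v}
  [∀ i, NormedAddCommGroup (X i)] [∀ i, NormedSpace 𝕜 (X i)]
  [∀ i, NormedAddCommGroup (Y i)] [∀ i, NormedSpace 𝕜 (Y i)] {p : ℝ≥0∞} [Fact (1 ≤ p)]
  (A : ∀ i, X i →L[𝕜] Y i) (hA : BddAbove (Set.range fun i => ‖A i‖))

theorem tendsto_eval_lp_weakNull (i : ι) :
    Tendsto (fun x : lp X p => x i) (weakNull 𝕜 (lp X p)) (weakNull 𝕜 (X i)) :=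
  tendsto_weakNull_of_norm_le (lp.evalCLM 𝕜 X p i) fun x =>
    lp.norm_apply_le_norm (zero_lt_one.trans_le (Fact.out : 1 ≤ p)).ne' x i

theorem tendsto_single_weakNull [DecidableEq ι] (i : ι) :
    Tendsto (lp.single (E := X) p i) (weakNull 𝕜 (X i)) (weakNull 𝕜 (lp X p)) :=
  tendsto_weakNull_of_norm_le (lp.singleContinuousLinearMap 𝕜 X p i) fun x =>
    (lp.norm_single (zero_lt_one.trans_le (Fact.out : 1 ≤ p)) i x).le

/-- Stacking weakly null points of the summands: the list `L` tells to which summand each successive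
level belongs, so that the summand `i` is given as many levels as `i` occurs in `L`. -/
theorem ellNorm_iterLimsup_count_le [DecidableEq ι] (F : Finset ι) (L : List ι) (z : lp X p) :
    ellNorm p ((F : Set ι).indicator fun i => iterLimsup (A i) (L.count i) (z i)) ≤
      iterLimsup (lpMap p A hA) L.length z := by
  induction L generalizing z with
  | nil =>
    refine (ellNorm_indicator_le p _ _).trans_eq ?_
    rw [List.length_nil, iterLimsup_zero, enorm_lp_eq_ellNorm]
    rfl
  | cons j L ih =>
    set a : ι → ℝ≥0∞ := fun i => iterLimsup (A i) (L.count i) (z i) with ha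
    let φ : ℝ≥0∞ → ℝ≥0∞ := fun t => ellNorm p ((F : Set ι).indicator (Function.update a j t))
    have hφ : Monotone φ := fun s t hst => ellNorm_mono p fun i =>
      Set.indicator_le_indicator (Function.update_mono hst i)
    have hφc : Continuous φ := (continuous_ellNorm_indicator Fact.out F).comp
      (continuous_const.update j continuous_id)
    have hcount : (fun i => iterLimsup (A i) ((j :: L).count i) (z i)) =
        Function.update a j (limsup (fun x => iterLimsup (A j) (L.count j) (z j + x))
          (weakNull 𝕜 (X j))) := by
      ext i
      rcases eq_or_ne i j with rfl | hij
      · rw [Function.update_self, List.count_cons_self, iterLimsup_succ]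
      · rw [Function.update_of_ne hij, List.count_cons_of_ne hij.symm]
    rw [hcount, List.length_cons, iterLimsup_succ]
    change φ _ ≤ _
    rw [hφ.map_limsup_of_continuousAt _ hφc.continuousAt]
    refine le_trans (limsup_le_limsup (Eventually.of_forall fun x => ?_))
      ((tendsto_single_weakNull (p := p) j).limsup_comp_le_limsup
        (u := fun x => iterLimsup (lpMap p A hA) L.length (z + x)))
    refine le_trans (le_of_eq ?_) (ih (z + lp.single p j x))
    simp only [φ, Function.comp_apply]
    congr 2
    ext i
    rcases eq_or_ne i j with rfl | hij
    · simp
    · simp [ha, hij]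

theorem ellNorm_opSigma_le : (ellNorm p fun i => opSigma (A i)) ≤ opSigma (lpMap p A hA) := by
  classical
  refine ellNorm_le_of_forall_finset Fact.out fun F => ?_
  have hlim : Tendsto (fun n => fun i => iterLimsup (A i) n 0) atTop
      (𝓝 fun i => opSigma (A i)) := by
    refine tendsto_pi_nhds.2 fun i => ?_
    rw [opSigma_eq_iSup]
    exact tendsto_atTop_iSup (monotone_iterLimsup (A i) 0)
  refine le_of_tendsto (((continuous_ellNorm_indicator Fact.out F).tendsto _).comp hlim)
    (Eventually.of_forall fun n => ?_)
  -- every index of `F` is given `n` levels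
  let L : List ι := F.toList.flatMap fun i => List.replicate n i
  refine le_trans (ellNorm_mono p fun i => ?_) ((ellNorm_iterLimsup_count_le A hA F L 0).trans
    (iterLimsup_le_opSigma _ _))
  refine Set.indicator_le_indicator' fun hi => ?_
  refine monotone_iterLimsup (A i) 0 ?_
  refine List.replicate_sublist_iff.1 (List.sublist_flatten_of_mem ?_)
  exact List.mem_map.2 ⟨i, Finset.mem_toList.2 hi, rfl⟩

/-- Split `z` into its coordinates in `F` and the rest. -/
theorem enorm_lpMap_le (F : Finset ι) {τ : NNReal} (hτ : ∀ i ∉ F, ‖A i‖ ≤ τ) (z : lp X p) :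
    ‖lpMap p A hA z‖ₑ ≤ ellNorm p ((F : Set ι).indicator fun i => ‖A i (z i)‖ₑ) + τ * ‖z‖ₑ := by
  classical
  have hp0 : p ≠ 0 := (zero_lt_one.trans_le (Fact.out : 1 ≤ p)).ne'
  let zF : lp X p := ∑ i ∈ F, lp.single p i (z i)
  have hzF (i : ι) : zF i = if i ∈ F then z i else 0 := by
    simp only [zF, lp.coeFn_sum, Finset.sum_apply, lp.coeFn_single]
    exact Finset.sum_pi_single i _ F
  have hsplit : lpMap p A hA z = lpMap p A hA zF + lpMap p A hA (z - zF) := by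
    rw [← map_add, add_sub_cancel]
  rw [hsplit]
  refine (enorm_add_le _ _).trans (add_le_add (le_of_eq ?_) ?_)
  · rw [enorm_lp_eq_ellNorm]
    congr 1
    ext i
    by_cases hi : i ∈ F
    · rw [Set.indicator_of_mem (by exact hi), lpMap_apply, hzF, if_pos hi]
    · rw [Set.indicator_of_notMem (by exact hi), lpMap_apply, hzF, if_neg hi, map_zero, enorm_zero]
  · have : ‖lpMap p A hA (z - zF)‖ ≤ ‖((τ : ℝ) : 𝕜) • z‖ := by
      refine lp.norm_mono hp0 fun i => ?_
      rw [lpMap_apply, lp.coeFn_sub, Pi.sub_apply, hzF, lp.coeFn_smul, Pi.smul_apply, norm_smul,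
        RCLike.norm_ofReal, NNReal.abs_eq]
      split_ifs with hi
      · rw [sub_self, map_zero, norm_zero]
        positivity
      · rw [sub_zero]
        exact (A i).le_of_opNorm_le (hτ i hi) _
    refine (enorm_le_iff_norm_le.2 this).trans_eq ?_
    rw [enorm_smul]
    congr 1
    rw [← ofReal_norm, RCLike.norm_ofReal, NNReal.abs_eq, ENNReal.ofReal_coe_nnreal]

/-- Along a weakly null net all coordinates in a finite set are controlled at once; the remaining
ones contribute at most the supremum of the norms of the remaining operators. -/
theorem iterLimsup_lpMap_le (F : Finset ι) {τ : NNReal} (hτ : ∀ i ∉ F, ‖A i‖ ≤ τ) (n : ℕ)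
    (z : lp X p) :
    iterLimsup (lpMap p A hA) n z ≤
      ellNorm p ((F : Set ι).indicator fun i => iterLimsup (A i) n (z i)) + τ * (‖z‖ₑ + n) := by
  induction n generalizing z with
  | zero => simpa [iterLimsup_zero] using enorm_lpMap_le A hA F hτ z
  | succ n ih =>
    have key (η : ℝ≥0∞) (hη : 0 < η) : iterLimsup (lpMap p A hA) (n + 1) z ≤
        ellNorm p ((F : Set ι).indicator fun i => iterLimsup (A i) (n + 1) (z i) + η) +
          τ * (‖z‖ₑ + (n + 1 : ℕ)) := by
      have hF : ∀ᶠ x in weakNull 𝕜 (lp X p), ∀ i ∈ F,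
          iterLimsup (A i) n (z i + x i) ≤ iterLimsup (A i) (n + 1) (z i) + η := by
        refine (eventually_all_finset F).2 fun i _ => ?_
        by_cases htop : iterLimsup (A i) (n + 1) (z i) = ∞
        · simp [htop]
        · exact ((tendsto_eval_lp_weakNull i).eventually (eventually_lt_of_limsup_lt
            (ENNReal.lt_add_right htop hη.ne'))).mono fun x hx => hx.le
      refine limsup_le_of_le (by isBoundedDefault) ?_
      filter_upwards [hF, eventually_weakNull_norm_le 𝕜] with x hx hx1
      refine (ih (z + x)).trans (add_le_add (ellNorm_mono p fun i => ?_) ?_)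
      · exact Set.indicator_le_indicator' fun hi => hx i hi
      · refine mul_le_mul_right ?_ _
        calc ‖z + x‖ₑ + n ≤ ‖z‖ₑ + 1 + n := by
              gcongr
              refine (enorm_add_le _ _).trans ?_
              gcongr
              rw [← ofReal_norm]
              exact ENNReal.ofReal_le_one.2 hx1
          _ = ‖z‖ₑ + (n + 1 : ℕ) := by push_cast; ring
    have hcont : Continuous fun η : ℝ≥0∞ =>
        ellNorm p ((F : Set ι).indicator fun i => iterLimsup (A i) (n + 1) (z i) + η) +
          τ * (‖z‖ₑ + (n + 1 : ℕ)) :=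
      ((continuous_ellNorm_indicator Fact.out F).comp
        (continuous_pi fun i => continuous_const.add continuous_id)).add continuous_const
    refine ge_of_tendsto ((hcont.tendsto' 0 _ ?_).mono_left nhdsWithin_le_nhds)
      (eventually_nhdsWithin_of_forall (s := Set.Ioi 0) key)
    simp

theorem opSigmaN_lpMap_le (h0 : Tendsto (fun i => ‖A i‖) cofinite (𝓝 0)) (n : ℕ) :
    opSigmaN n (lpMap p A hA) ≤ ellNorm p fun i => opSigmaN n (A i) := by
  simp_rw [opSigmaN_eq_iterLimsup]
  refine ENNReal.le_of_forall_pos_le_add fun ε hε _ => ?_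
  have hτ : 0 < ε / (n + 1) := by positivity
  have hfin : {i | ¬ ‖A i‖ < (ε / (n + 1) : NNReal)}.Finite :=
    eventually_cofinite.1 (h0.eventually (gt_mem_nhds (by exact_mod_cast hτ)))
  refine (iterLimsup_lpMap_le A hA hfin.toFinset (τ := ε / (n + 1)) (fun i hi => ?_) n 0).trans ?_
  · simp only [Set.Finite.mem_toFinset, Set.mem_ofPred_eq, not_not] at hi
    exact hi.le
  · refine add_le_add (ellNorm_indicator_le p _ _) ?_
    rw [enorm_zero, zero_add]
    have : ε / (n + 1) * n ≤ ε := by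
      rw [div_mul_eq_mul_div, div_le_iff₀ (by positivity)]
      gcongr
      simp
    exact_mod_cast this

theorem opSigma_lpMap_le (h0 : Tendsto (fun i => ‖A i‖) cofinite (𝓝 0)) :
    opSigma (lpMap p A hA) ≤ ellNorm p fun i => opSigma (A i) :=
  iSup₂_le fun n hn => (opSigmaN_lpMap_le A hA h0 n).trans (ellNorm_mono p fun i =>
    le_iSup₂ (f := fun (n : ℕ) (_ : 1 ≤ n) => sigmaN n (adjointBall (A i))) n hn)

end DirectSum

/-! ### Diagonal operators whose norms do not tend to zero -/

section NotNull

variable {𝕜 : Type w} [RCLike 𝕜]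

/-- If `A` is at least `g n` on all halved differences of two disjoint `n`-element subsums of a
sequence in the unit ball, then so are the iterated upper limits: along a free ultrafilter the
halved differences of two terms are weakly null. -/
theorem le_iterLimsup_of_half_sub {X : Type u} [NormedAddCommGroup X] [NormedSpace 𝕜 X]
    {Y : Type v} [NormedAddCommGroup Y] [NormedSpace 𝕜 Y] (A : X →L[𝕜] Y) (y : ℕ → X)
    (hy : ∀ k, ‖y k‖ ≤ 1) (g : ℕ → ℝ≥0∞)
    (h : ∀ I J : Finset ℕ, Disjoint I J → I.card = J.card →
      g I.card ≤ ‖A ((2⁻¹ : 𝕜) • (∑ k ∈ I, y k - ∑ k ∈ J, y k))‖ₑ)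
    (m : ℕ) : g m ≤ iterLimsup A m 0 := by
  have key (m : ℕ) : ∀ I J : Finset ℕ, Disjoint I J → I.card = J.card →
      g (I.card + m) ≤ iterLimsup A m ((2⁻¹ : 𝕜) • (∑ k ∈ I, y k - ∑ k ∈ J, y k)) := by
    induction m with
    | zero => exact h
    | succ m ih =>
      intro I J hIJ hcard
      refine le_limsup_of_frequently_le' fun hev => ?_
      have hfree (s : Finset ℕ) : ∀ᶠ k in (hyperfilter ℕ : Filter ℕ), k ∉ s :=
        hyperfilter_le_cofinite (s.finite_toSet.compl_mem_cofinite)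
      obtain ⟨j, hj, hjIJ⟩ := (((tendsto_half_sub_weakNull (𝕜 := 𝕜) (hyperfilter ℕ) y
        hy).eventually hev).curry.and (hfree (I ∪ J))).exists
      obtain ⟨i, hi, hiIJ⟩ := (hj.and (hfree (insert j (I ∪ J)))).exists
      simp only [Finset.mem_insert, Finset.mem_union, not_or] at hjIJ hiIJ
      refine hi ?_
      have := ih (insert i I) (insert j J) (by
        simp only [Finset.disjoint_insert_left, Finset.disjoint_insert_right, Finset.mem_insert]
        tauto) (by
        rw [Finset.card_insert_of_notMem hiIJ.2.1, Finset.card_insert_of_notMem hjIJ.2, hcard])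
      rw [Finset.card_insert_of_notMem hiIJ.2.1, Finset.sum_insert hiIJ.2.1,
        Finset.sum_insert hjIJ.2, add_right_comm, add_assoc] at this
      refine this.trans_eq (congrArg (iterLimsup A m) ?_)
      rw [← smul_add]
      congr 1
      abel
  simpa using key m ∅ ∅ (by simp) rfl

variable {ι : Type*} {X : ι → Type u} {Y : ι → Type v}
  [∀ i, NormedAddCommGroup (X i)] [∀ i, NormedSpace 𝕜 (X i)]
  [∀ i, NormedAddCommGroup (Y i)] [∀ i, NormedSpace 𝕜 (Y i)]
  (A : ∀ i, X i →L[𝕜] Y i) (hA : BddAbove (Set.range fun i => ‖A i‖))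

/-- For `p < ∞`, vectors `x i` in the summands on which `A i` is bounded below by `c` for infinitely
many `i` span a copy of `ℓ_p` in the range of the operator. -/
theorem opSigma_lpMap_eq_top_of_ne_top {p : ℝ≥0∞} [Fact (1 ≤ p)] (hp : p ≠ ∞) (x : ∀ i, X i)
    (hx : ∀ i, ‖x i‖ ≤ 1) {c : ℝ≥0∞} (hc : c ≠ 0) (e : ℕ ↪ ι)
    (he : ∀ k, c ≤ ‖A (e k) ((2⁻¹ : 𝕜) • x (e k))‖ₑ) : opSigma (lpMap p A hA) = ∞ := by
  classical
  have hp1 : 1 ≤ p := Fact.out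
  have hq := toReal_exponent_pos hp1 hp
  have key := le_iterLimsup_of_half_sub (lpMap p A hA) (fun k => lp.single p (e k) (x (e k)))
    (fun k => (lp.norm_single (zero_lt_one.trans_le hp1) _ _).trans_le (hx _))
    (fun n => (n * c ^ p.toReal) ^ (1 / p.toReal)) (by
      intro I J hIJ _
      rw [enorm_lp_eq_ellNorm]
      refine le_trans ?_ (ellNorm_indicator_le p (I.map e : Finset ι) _)
      rw [ellNorm_indicator_of_ne_top hp1 hp, Finset.sum_map, ← nsmul_eq_mul]
      refine ENNReal.rpow_le_rpow (Finset.card_nsmul_le_sum _ _ _ fun k hk => ?_) (by positivity)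
      refine ENNReal.rpow_le_rpow ((he k).trans_eq ?_) hq.le
      rw [lpMap_apply]
      congr 2
      have hI : (∑ l ∈ I, lp.single p (e l) (x (e l)) : lp X p) (e k) = x (e k) := by
        rw [lp.coeFn_sum, Finset.sum_apply, Finset.sum_eq_single_of_mem k hk, lp.single_apply_self]
        exact fun l _ hl => lp.single_apply_ne p _ _ fun h => hl (e.injective h).symm
      have hJ : (∑ l ∈ J, lp.single p (e l) (x (e l)) : lp X p) (e k) = 0 := by
        rw [lp.coeFn_sum, Finset.sum_apply]
        refine Finset.sum_eq_zero fun l hl => lp.single_apply_ne p _ _ fun h => ?_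
        exact Finset.disjoint_left.1 hIJ hk (e.injective h ▸ hl)
      rw [lp.coeFn_smul, Pi.smul_apply, lp.coeFn_sub, Pi.sub_apply, hI, hJ, sub_zero])
  by_contra htop
  obtain ⟨n, hn⟩ := ENNReal.exists_nat_mul_gt
    (a := c ^ p.toReal) (b := opSigma (lpMap p A hA) ^ p.toReal)
    (by simp [ENNReal.rpow_eq_zero_iff, hc, hq.le]) (ENNReal.rpow_ne_top_of_nonneg hq.le htop)
  refine hn.not_ge ?_
  rw [← ENNReal.rpow_inv_le_iff hq, ← one_div]
  exact (key n).trans (iterLimsup_le_opSigma _ _)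

/-- For `p = ∞`, infinitely many summands on which `A` is bounded below are indexed by the finite
sets of natural numbers. The sequence whose `k`-th term has the sign `1` or `-1` in the summand `F`
according as `k ∈ F` or not spans a copy of `ℓ₁`. -/
theorem opSigma_lpMap_top_eq_top (x : ∀ i, X i)
    (hx : ∀ i, ‖x i‖ ≤ 1) {c : ℝ≥0∞} (hc : c ≠ 0) (e : Finset ℕ ↪ ι)
    (he : ∀ k, c ≤ ‖A (e k) (x (e k))‖ₑ) : opSigma (lpMap ∞ A hA) = ∞ := by
  classical
  let s (k : ℕ) (i : ι) : 𝕜 := if k ∈ Function.invFun e i then 1 else -1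
  have hs (k : ℕ) (i : ι) : ‖s k i • x i‖ ≤ 1 := by
    have : ‖s k i‖ = 1 := by
      simp only [s]
      split_ifs <;> simp
    rw [norm_smul, this, one_mul]
    exact hx i
  let y (k : ℕ) : lp X ∞ := ⟨fun i => s k i • x i,
    memℓp_infty ⟨1, by rintro _ ⟨i, rfl⟩; exact hs k i⟩⟩
  have key := le_iterLimsup_of_half_sub (𝕜 := 𝕜) (lpMap ∞ A hA) y
    (fun k => lp.norm_le_of_forall_le zero_le_one (hs k)) (fun n => n * c) (by
      intro I J hIJ hcard
      rw [enorm_lp_eq_ellNorm, ellNorm_top]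
      refine le_iSup_of_le (e I) ?_
      have hinv : Function.invFun e (e I) = I := Function.leftInverse_invFun e.injective I
      have hI : (∑ k ∈ I, y k : lp X ∞) (e I) = (I.card : 𝕜) • x (e I) := by
        rw [lp.coeFn_sum, Finset.sum_apply, Finset.sum_congr rfl (g := fun _ => x (e I)),
          Finset.sum_const, Nat.cast_smul_eq_nsmul]
        intro k hk
        change s k (e I) • x (e I) = _
        simp only [s, hinv, if_pos hk, one_smul]
      have hJ : (∑ k ∈ J, y k : lp X ∞) (e I) = -((I.card : 𝕜) • x (e I)) := by
        rw [lp.coeFn_sum, Finset.sum_apply, Finset.sum_congr rfl (g := fun _ => -x (e I)),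
          Finset.sum_const, hcard, smul_neg, Nat.cast_smul_eq_nsmul]
        intro k hk
        change s k (e I) • x (e I) = _
        simp only [s, hinv, if_neg (Finset.disjoint_right.1 hIJ hk), neg_smul, one_smul]
      have hsum : ((2⁻¹ : 𝕜) • (∑ k ∈ I, y k - ∑ k ∈ J, y k) : lp X ∞) (e I) =
          (I.card : 𝕜) • x (e I) := by
        rw [lp.coeFn_smul, Pi.smul_apply, lp.coeFn_sub, Pi.sub_apply, hI, hJ, sub_neg_eq_add,
          ← two_smul 𝕜, smul_smul, inv_mul_cancel₀ two_ne_zero, one_smul]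
      rw [lpMap_apply, hsum, map_smul, enorm_smul]
      gcongr
      · rw [← ofReal_norm, RCLike.norm_natCast, ENNReal.ofReal_natCast]
      · exact he I)
  by_contra htop
  obtain ⟨n, hn⟩ := ENNReal.exists_nat_mul_gt hc htop
  exact hn.not_ge ((key n).trans (iterLimsup_le_opSigma _ _))

theorem tendsto_norm_of_opSigma_ne_top {p : ℝ≥0∞} [Fact (1 ≤ p)]
    (h : opSigma (lpMap p A hA) ≠ ∞) : Tendsto (fun i => ‖A i‖) cofinite (𝓝 0) := by
  by_contra hnot
  obtain ⟨δ, hδ, hinf⟩ : ∃ δ > 0, {i | δ < ‖A i‖}.Infinite := by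
    by_contra! hfin
    refine hnot (tendsto_order.2 ⟨fun a ha => Eventually.of_forall fun i =>
      ha.trans_le (norm_nonneg _), fun a ha => ?_⟩)
    refine eventually_cofinite.2 ((hfin (a / 2) (half_pos ha)).subset fun i hi => ?_)
    exact (half_lt_self ha).trans_le (not_lt.1 hi)
  have hex (i : ι) : ∃ x : X i, ‖x‖ ≤ 1 ∧ (δ < ‖A i‖ → δ ≤ ‖A i x‖) := by
    by_cases hi : δ < ‖A i‖
    · obtain ⟨x, hx, hlt⟩ := (A i).exists_lt_apply_of_lt_opNorm hi
      exact ⟨x, hx.le, fun _ => hlt.le⟩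
    · exact ⟨0, by simp, fun h => (hi h).elim⟩
  choose x hx hAx using hex
  have hinf' : Infinite {i | δ < ‖A i‖} := hinf.to_subtype
  let e : ℕ ↪ {i | δ < ‖A i‖} := Infinite.natEmbedding _
  have he (k : ℕ) : ENNReal.ofReal δ ≤ ‖A (e k) (x (e k))‖ₑ := by
    rw [← ofReal_norm]
    exact ENNReal.ofReal_le_ofReal (hAx _ (e k).2)
  have hδ' : ENNReal.ofReal δ ≠ 0 := (ENNReal.ofReal_pos.2 hδ).ne'
  by_cases hp : p = ∞
  · subst hp
    exact h (opSigma_lpMap_top_eq_top A hA x hx hδ'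
      ((Denumerable.eqv (Finset ℕ)).toEmbedding.trans (e.trans (Function.Embedding.subtype _)))
      fun F => he _)
  · refine h (opSigma_lpMap_eq_top_of_ne_top A hA hp x hx
      (c := ‖(2⁻¹ : 𝕜)‖ₑ * ENNReal.ofReal δ) (mul_ne_zero (by simp) hδ')
      (e.trans (Function.Embedding.subtype _)) fun k => ?_)
    rw [map_smul, enorm_smul]
    gcongr
    exact he k

end NotNull

end Szlenk

theorem mainTheorem6 {𝕜 : Type*} [RCLike 𝕜] (p : ℝ≥0∞) [Fact (1 ≤ p)]
    {Λ : Type*} [Nonempty Λ] {X Y : Λ → Type*}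
    [∀ i, NormedAddCommGroup (X i)] [∀ i, NormedSpace 𝕜 (X i)] [∀ i, CompleteSpace (X i)]
    [∀ i, NormedAddCommGroup (Y i)] [∀ i, NormedSpace 𝕜 (Y i)] [∀ i, CompleteSpace (Y i)]
    (A : ∀ i, X i →L[𝕜] Y i) (hA : BddAbove (Set.range fun i => ‖A i‖)) :
    (Szlenk.HasSummableIndex (Szlenk.lpMap p A hA) ↔
      Tendsto (fun i => ‖A i‖) cofinite (𝓝 0) ∧
        (∀ i, Szlenk.opSigma (A i) ≠ ∞) ∧ Memℓp (fun i => (Szlenk.opSigma (A i)).toReal) p) ∧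
    (Szlenk.HasSummableIndex (Szlenk.lpMap p A hA) →
      Szlenk.opSigma (Szlenk.lpMap p A hA) =
        Szlenk.ellNorm p fun i => Szlenk.opSigma (A i)) ∧
    (Finite Λ →
      (∀ n : ℕ, 1 ≤ n → Szlenk.opSigmaN n (Szlenk.lpMap p A hA) ≤
        Szlenk.ellNorm p fun i => Szlenk.opSigmaN n (A i)) ∧
      Szlenk.opSigma (Szlenk.lpMap p A hA) =
        Szlenk.ellNorm p fun i => Szlenk.opSigma (A i)) := by
  have heq (h0 : Tendsto (fun i => ‖A i‖) cofinite (𝓝 0)) :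
      Szlenk.opSigma (Szlenk.lpMap p A hA) = Szlenk.ellNorm p fun i => Szlenk.opSigma (A i) :=
    (Szlenk.opSigma_lpMap_le A hA h0).antisymm (Szlenk.ellNorm_opSigma_le A hA)
  rw [Szlenk.hasSummableIndex_iff, ← Szlenk.ellNorm_ne_top_iff Fact.out]
  refine ⟨⟨fun h => ?_, fun h => ?_⟩, fun h => ?_, fun hΛ => ?_⟩
  · have h0 := Szlenk.tendsto_norm_of_opSigma_ne_top A hA h
    exact ⟨h0, heq h0 ▸ h⟩
  · exact (heq h.1).symm ▸ h.2
  · exact heq (Szlenk.tendsto_norm_of_opSigma_ne_top A hA h)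
  · have h0 : Tendsto (fun i => ‖A i‖) cofinite (𝓝 0) := by simp
    exact ⟨fun n _ => Szlenk.opSigmaN_lpMap_le A hA h0 n, heq h0⟩
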